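/- Let $(M,d)$ be a metric space, $X$ a real Banach space with closed unit ball $B_X$, and $\alpha\ge 0$. Let $\varphi:M\twoheadrightarrow X$ be a correspondence, i.e. a map assigning to each $a\in M$ a subset $\varphi(a)\subseteq X$, whose values are non-empty, closed and convex. Assume that $\varphi$ is lower hemicontinuous: for every $a\in M$ and every open $U\subseteq X$ with $\varphi(a)\cap U\ne\emptyset$ there is an open set $V\ni a$ with $\varphi(v)\cap U\neq\emptyset$ for all $v\in V$. Assume further that for every $\varepsilon>0$ the correspondence $\varphi$ is lower pointwise $(\alpha+\varepsilon)$-Lipschitz, i.e. for all $a,b\in M$ and all $y\in\varphi(b)$, $$\varphi(a)\cap\bigl(y+(\alpha+\varepsilon)\,d(b,a)\,B_X\bigr)\neq\emptyset .$$ For $\beta\ge 0$, a map $f:M\to X$ is called pointwise $\beta$-Lipschitz on a set $S\subseteq M$ if for every $b\in S$ $$\limsup_{r\to0^+}\Bigl(r^{-1}\sup\{\|f(b)-f(a)\| : a\in M,\ d(b,a)\le r\}\Bigr)\le\beta ,$$ and a selection of $\varphi$ is a map $f:M\to X$ with $f(a)\in\varphi(a)$ for all $a\in M$. Then, for every $\beta>\alpha$,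 there exists a continuous selection of $\varphi$ that is pointwise $\beta$-Lipschitz on a dense subset of $M$. If, additionally, $\varphi$ has a bounded continuous selection, then, for every $\beta>\alpha$, there exists a bounded continuous selection of $\varphi$ that is pointwise $\beta$-Lipschitz on a dense subset of $M$. -/

import Mathlib

open Set Filter Topology
open scoped NNReal ENNReal

/-- `f` is a selection of the correspondence `φ : A ↠ B`. -/
def IsSelection {A B : Type*} (φ : A → Set B) (f : A → B) : Prop :=
  ∀ a, f a ∈ φ a

/-- `f` is pointwise `α`-Lipschitz at `b`:
`limsup_{r → 0⁺} r⁻¹ * sup {d(f b, f a) | a ∈ closedBall b r} ≤ α`.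
The supremum and the upper limit are taken in `[0, ∞]`, so that they exist for every map `f`. -/
def PointwiseLipschitzAt {M M' : Type*} [MetricSpace M] [MetricSpace M']
    (α : ℝ≥0) (f : M → M') (b : M) : Prop :=
  limsup (fun r : ℝ => (ENNReal.ofReal r)⁻¹ * ⨆ a ∈ Metric.closedBall b r, edist (f b) (f a))
    (𝓝[>] (0 : ℝ)) ≤ (α : ℝ≥0∞)

/-- `f` is pointwise `α`-Lipschitz at every point of the set `S`. -/
def PointwiseLipschitzOn {M M' : Type*} [MetricSpace M] [MetricSpace M']
    (α : ℝ≥0) (f : M → M') (S : Set M) : Prop :=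
  ∀ b ∈ S, PointwiseLipschitzAt α f b

/-- The correspondence `φ : M ↠ X` is lower pointwise `α`-Lipschitz at `b`: for every `y ∈ φ b`
and every `a`, the set `φ a` meets the closed ball of radius `α * d(b, a)` about `y`. -/
def LowerPointwiseLipschitzAt {M X : Type*} [MetricSpace M] [NormedAddCommGroup X]
    (α : ℝ≥0) (φ : M → Set X) (b : M) : Prop :=
  ∀ y ∈ φ b, ∀ a : M, (φ a ∩ Metric.closedBall y ((α : ℝ) * dist b a)).Nonempty

/-- The correspondence `φ` is lower pointwise `α`-Lipschitz at every point. -/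
def LowerPointwiseLipschitz {M X : Type*} [MetricSpace M] [NormedAddCommGroup X]
    (α : ℝ≥0) (φ : M → Set X) : Prop :=
  ∀ b, LowerPointwiseLipschitzAt α φ b

/-! Fix `α < K < L < β`. Applying Michael's theorem to `φ` cut down by balls of radius `L * dist a
b` about `y ∈ φ b` gives continuous selections through `(b, y)` that are `L`-Lipschitz at `b`.
Convexity and a partition of unity graft these onto any continuous selection near the points of a
separated set (`IsSelection.exists_perturbation`).

This is iterated over ever finer maximal separated sets. With `B` the points already treated, stage
`n` moves the selection by at most `ε / 2 ^ (n + 1) * min 1 (dist a B)`. All stages after `b` is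
treated thus add at most `ε` to the Lipschitz constant `L` at `b`. The limit is uniform, hence
continuous; it stays within `ε` of the initial selection, so boundedness survives. -/

/-! ### Stability of lower hemicontinuity -/

/-- The intersection of a lower hemicontinuous correspondence with one whose graph is open
is lower hemicontinuous. -/
theorem LowerHemicontinuousAt.inter_of_isOpen_graph {A B : Type*} [TopologicalSpace A]
    [TopologicalSpace B] {φ ψ : A → Set B} {x : A} (hφ : LowerHemicontinuousAt φ x)
    (hψ : IsOpen {p : A × B | p.2 ∈ ψ p.1}) :
    LowerHemicontinuousAt (fun a => φ a ∩ ψ a) x := by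
  rw [lowerHemicontinuousAt_iff] at hφ ⊢
  rintro u hu ⟨y, ⟨hyφ, hyψ⟩, hyu⟩
  obtain ⟨V, W, hV, hW, hxV, hyW, hVW⟩ := isOpen_prod_iff.1 hψ x y hyψ
  filter_upwards [hφ (W ∩ u) (hW.inter hu) ⟨y, hyφ, hyW, hyu⟩, hV.mem_nhds hxV]
  rintro a ⟨z, hz, hzW, hzu⟩ haV
  exact ⟨z, ⟨hz, hVW (Set.mk_mem_prod haV hzW)⟩, hzu⟩

theorem LowerHemicontinuousAt.closure {A B : Type*} [TopologicalSpace A] [TopologicalSpace B]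
    {φ : A → Set B} {x : A} (hφ : LowerHemicontinuousAt φ x) :
    LowerHemicontinuousAt (fun a => _root_.closure (φ a)) x := by
  rw [lowerHemicontinuousAt_iff] at hφ ⊢
  intro u hu h
  rw [closure_inter_open_nonempty_iff hu] at h
  filter_upwards [hφ u hu h] with a ha
  exact ha.mono (inter_subset_inter_left _ subset_closure)

theorem isOpen_graph_ball {A B : Type*} [TopologicalSpace A] [PseudoMetricSpace B]
    {f : A → B} {r : A → ℝ} (hf : Continuous f) (hr : Continuous r) :
    IsOpen {p : A × B | p.2 ∈ Metric.ball (f p.1) (r p.1)} :=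
  isOpen_lt (continuous_snd.dist (hf.comp continuous_fst)) (hr.comp continuous_fst)

/-! ### Michael's selection theorem -/

section Michael

variable {A X : Type*} [TopologicalSpace A] [NormalSpace A] [ParacompactSpace A]
  [NormedAddCommGroup X] [NormedSpace ℝ X] {φ : A → Set X}

/-- By lower hemicontinuity a point of `φ a` is a valid constant choice near `a`; thickenings are
convex, so a partition of unity glues these constants. -/
theorem LowerHemicontinuous.exists_continuous_mem_thickening (hφ : LowerHemicontinuous φ)
    (hne : ∀ a, (φ a).Nonempty) (hconvex : ∀ a, Convex ℝ (φ a)) {r : ℝ} (hr : 0 < r) :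
    ∃ f : C(A, X), ∀ a, f a ∈ Metric.thickening r (φ a) := by
  refine exists_continuous_forall_mem_convex_of_local_const
    (fun a => (hconvex a).thickening r) fun a => ?_
  obtain ⟨y, hy⟩ := hne a
  refine ⟨y, ?_⟩
  filter_upwards [lowerHemicontinuousAt_iff.1 (hφ a) (Metric.ball y r) Metric.isOpen_ball
    ⟨y, hy, Metric.mem_ball_self hr⟩]
  rintro b ⟨z, hz, hzy⟩
  exact Metric.mem_thickening_iff.2 ⟨z, hz, Metric.mem_ball'.1 hzy⟩

/-- **Michael's selection theorem**. -/
theorem LowerHemicontinuous.exists_continuous_selection [CompleteSpace X]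
    (hφ : LowerHemicontinuous φ) (hne : ∀ a, (φ a).Nonempty) (hclosed : ∀ a, IsClosed (φ a))
    (hconvex : ∀ a, Convex ℝ (φ a)) :
    ∃ f : A → X, Continuous f ∧ IsSelection φ f := by
  -- The shape `4 / 2 / 2 ^ n` is the one `cauchySeq_of_le_geometric_two` expects.
  have step (n : ℕ) (f : {f : C(A, X) // ∀ a, f a ∈ Metric.thickening (1 / 2 ^ n) (φ a)}) :
      ∃ g : {f : C(A, X) // ∀ a, f a ∈ Metric.thickening (1 / 2 ^ (n + 1)) (φ a)},
        ∀ a, dist (f.1 a) (g.1 a) ≤ 4 / 2 / 2 ^ n := by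
    obtain ⟨f, hf⟩ := f
    obtain ⟨g, hg⟩ := LowerHemicontinuous.exists_continuous_mem_thickening
      (φ := fun a => φ a ∩ Metric.ball (f a) (1 / 2 ^ n))
      (fun a => LowerHemicontinuousAt.inter_of_isOpen_graph (hφ a) (isOpen_graph_ball f.continuous continuous_const))
      (fun a => by
        obtain ⟨z, hz, h⟩ := Metric.mem_thickening_iff.1 (hf a)
        exact ⟨z, hz, Metric.mem_ball'.2 h⟩)
      (fun a => (hconvex a).inter (convex_ball _ _))
      (r := 1 / 2 ^ (n + 1)) (by positivity)
    refine ⟨⟨g, fun a => Metric.thickening_subset_of_subset _ inter_subset_left (hg a)⟩,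
      fun a => ?_⟩
    obtain ⟨z, ⟨-, hz⟩, h⟩ := Metric.mem_thickening_iff.1 (hg a)
    rw [Metric.mem_ball] at hz
    have hle : (1 : ℝ) / 2 ^ (n + 1) ≤ 1 / 2 ^ n := by
      gcongr
      · norm_num
      · omega
    have h4 : (4 : ℝ) / 2 / 2 ^ n = 1 / 2 ^ n + 1 / 2 ^ n := by ring
    rw [h4]
    show dist (f a) (g a) ≤ _
    linarith [dist_triangle_right (f a) (g a) z, dist_comm z (f a)]
  choose next hnext using step
  obtain ⟨f₀, hf₀⟩ := hφ.exists_continuous_mem_thickening hne hconvex one_pos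
  let F (n : ℕ) : {f : C(A, X) // ∀ a, f a ∈ Metric.thickening (1 / 2 ^ n) (φ a)} :=
    Nat.rec ⟨f₀, by simpa using hf₀⟩ (fun n f => next n f) n
  have hF (a : A) (n : ℕ) : dist ((F n).1 a) ((F (n + 1)).1 a) ≤ 4 / 2 / 2 ^ n :=
    hnext n (F n) a
  choose f hf using fun a =>
    cauchySeq_tendsto_of_complete (cauchySeq_of_le_geometric_two (hF a))
  have hdist (a : A) (n : ℕ) : dist ((F n).1 a) (f a) ≤ 4 / 2 ^ n :=
    dist_le_of_le_geometric_two_of_tendsto (hF a) (hf a) n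
  have hzero (C : ℝ) : Tendsto (fun n : ℕ => C / 2 ^ n) atTop (𝓝 0) :=
    tendsto_const_nhds.div_atTop (tendsto_pow_atTop_atTop_of_one_lt one_lt_two)
  refine ⟨f, ?_, fun a => ?_⟩
  · have hunif : TendstoUniformly (fun n a => (F n).1 a) f atTop := by
      rw [Metric.tendstoUniformly_iff]
      intro ε hε
      filter_upwards [(hzero 4).eventually_lt_const hε] with n hn a
      rw [dist_comm]
      exact (hdist a n).trans_lt hn
    exact hunif.continuous (Frequently.of_forall fun n => (F n).1.continuous)
  · rw [← (hclosed a).closure_eq, Metric.mem_closure_iff]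
    intro ε hε
    obtain ⟨n, hn⟩ := ((hzero 5).eventually_lt_const hε).exists
    obtain ⟨z, hz, h⟩ := Metric.mem_thickening_iff.1 ((F n).2 a)
    have h5 : (5 : ℝ) / 2 ^ n = 4 / 2 ^ n + 1 / 2 ^ n := by ring
    exact ⟨z, hz, by linarith [dist_triangle_left (f a) z ((F n).1 a), hdist a n]⟩

end Michael

/-! ### Selections that are Lipschitz at one point -/

/-- Through every point of the graph of a lower pointwise Lipschitz correspondence passes a
continuous selection that is Lipschitz at that point. -/
theorem LowerPointwiseLipschitz.exists_continuous_selection_dist_le {M X : Type*}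
    [MetricSpace M] [NormedAddCommGroup X] [NormedSpace ℝ X] [CompleteSpace X] {φ : M → Set X}
    {K L : ℝ≥0} (hlip : LowerPointwiseLipschitz K φ) (hφ : LowerHemicontinuous φ)
    (hclosed : ∀ a, IsClosed (φ a)) (hconvex : ∀ a, Convex ℝ (φ a)) (hKL : K < L)
    (b : M) {y : X} (hy : y ∈ φ b) :
    ∃ g : M → X, Continuous g ∧ IsSelection φ g ∧ ∀ a, dist (g a) y ≤ L * dist a b := by
  have hnonempty (a : M) (ha : a ≠ b) : (φ a ∩ Metric.ball y (L * dist a b)).Nonempty := by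
    obtain ⟨z, hz, hzy⟩ := hlip b y hy a
    refine ⟨z, hz, (Metric.mem_closedBall.1 hzy).trans_lt ?_⟩
    rw [dist_comm b a]
    exact mul_lt_mul_of_pos_right (NNReal.coe_lt_coe.2 hKL) (dist_pos.2 ha)
  classical
  -- Open balls keep `ψ` lower hemicontinuous off `b`; at `b` the shrinking radius does.
  let ψ (a : M) : Set X := if a = b then {y} else φ a ∩ Metric.ball y (L * dist a b)
  have hψsub (a : M) : ψ a ⊆ φ a ∩ Metric.closedBall y (L * dist a b) := by
    by_cases ha : a = b
    · simp [ψ, ha, hy]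
    · simpa only [ψ, if_neg ha] using
        inter_subset_inter_right _ Metric.ball_subset_closedBall
  have hψne (a : M) : (ψ a).Nonempty := by
    by_cases ha : a = b
    · simp [ψ, ha]
    · simpa only [ψ, if_neg ha] using hnonempty a ha
  have hψconvex (a : M) : Convex ℝ (ψ a) := by
    by_cases ha : a = b
    · simp [ψ, ha]
    · simpa only [ψ, if_neg ha] using (hconvex a).inter (convex_ball _ _)
  have hψ : LowerHemicontinuous ψ := by
    refine lowerHemicontinuous_iff.2 fun a => lowerHemicontinuousAt_iff.2 fun u hu hau => ?_
    by_cases ha : a = b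
    · subst ha
      have hyu : y ∈ u := by simpa [ψ] using hau
      obtain ⟨s, hs, hsu⟩ := Metric.isOpen_iff.1 hu y hyu
      have hcont : Tendsto (fun x => (L : ℝ) * dist x a) (𝓝 a) (𝓝 0) := by
        have : Continuous fun x => (L : ℝ) * dist x a := by fun_prop
        simpa using this.tendsto a
      filter_upwards [hcont.eventually_lt_const hs] with x hx
      obtain ⟨z, hz⟩ := hψne x
      exact ⟨z, hz, hsu ((hψsub x hz).2.trans_lt hx)⟩
    · have h := lowerHemicontinuousAt_iff.1 (LowerHemicontinuousAt.inter_of_isOpen_graph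
        (ψ := fun x => Metric.ball y (L * dist x b)) (hφ a) (isOpen_graph_ball (f := fun _ : M => y) (r := fun x => L * dist x b)
          continuous_const (by fun_prop))) u hu (by simpa only [ψ, if_neg ha] using hau)
      filter_upwards [h, isOpen_ne.mem_nhds ha] with x hx hxb
      simpa only [ψ, if_neg hxb] using hx
  obtain ⟨g, hg, hgψ⟩ := LowerHemicontinuous.exists_continuous_selection
    (φ := fun a => closure (ψ a)) (fun a => LowerHemicontinuousAt.closure (hψ a)) (fun a => (hψne a).closure)
    (fun a => isClosed_closure) (fun a => (hψconvex a).closure)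
  have hmem (a : M) : g a ∈ φ a ∩ Metric.closedBall y (L * dist a b) :=
    closure_minimal (hψsub a) ((hclosed a).inter Metric.isClosed_closedBall) (hgψ a)
  exact ⟨g, hg, fun a => (hmem a).1, fun a => (hmem a).2⟩

/-! ### Perturbation near a separated set -/

theorem exists_maximal_separated (M : Type*) [PseudoMetricSpace M] {r : ℝ} (hr : 0 < r) :
    ∃ D : Set M, D.Pairwise (fun x y => r ≤ dist x y) ∧ ∀ x, ∃ b ∈ D, dist x b < r := by
  obtain ⟨D, hD⟩ := zorn_subset {D : Set M | D.Pairwise fun x y => r ≤ dist x y}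
    fun c hc hchain => ⟨⋃₀ c, (pairwise_sUnion hchain.directedOn).2 hc,
      fun s hs => subset_sUnion_of_mem hs⟩
  refine ⟨D, hD.prop, fun x => ?_⟩
  by_contra! h
  have hins : (insert x D).Pairwise fun x y => r ≤ dist x y :=
    hD.prop.insert fun b hb _ => ⟨h b hb, dist_comm x b ▸ h b hb⟩
  have := h x (hD.le_of_ge hins (subset_insert x D) (mem_insert x D))
  rw [dist_self] at this
  exact absurd this hr.not_ge

/-- A continuous selection can be changed, by a prescribed small amount, into one that is Lipschitz
at all points of a separated set. -/
theorem IsSelection.exists_perturbation {M X : Type*} [MetricSpace M] [NormedAddCommGroup X]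
    [NormedSpace ℝ X] {φ : M → Set X} (hconvex : ∀ a, Convex ℝ (φ a)) {L : ℝ≥0} {f : M → X}
    (hf : Continuous f) (hfφ : IsSelection φ f)
    (hg : ∀ b, ∃ g : M → X, Continuous g ∧ IsSelection φ g ∧
      ∀ a, dist (g a) (f b) ≤ L * dist a b)
    {η : M → ℝ} (hη : Continuous η) (hη₀ : ∀ a, 0 ≤ η a) {D : Set M} {r : ℝ} (hr : 0 < r)
    (hD : D.Pairwise fun x y => r ≤ dist x y) (hηD : ∀ b ∈ D, 0 < η b) :
    ∃ g : M → X, Continuous g ∧ IsSelection φ g ∧ (∀ a, dist (f a) (g a) ≤ η a) ∧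
      ∀ b ∈ D, ∃ δ > 0, ∀ a, dist a b ≤ δ → dist (g a) (g b) ≤ L * dist a b := by
  choose g hgc hgφ hgL using hg
  -- The bound `r / 8` lets at most one `b ∈ D` matter locally. The factor 2 leaves room: `g b` is
  -- usable on the `2 * δ` ball, while the constraint in `t` binds only within `δ`.
  have hδ (b : M) : ∃ δ, b ∈ D → 0 < δ ∧ δ ≤ r / 8 ∧
      ∀ a, dist a b < 2 * δ → dist (g b a) (f a) ≤ η a := by
    by_cases hb : b ∈ D
    · have hgb : g b b = f b := by simpa using hgL b b
      have hev : ∀ᶠ a in 𝓝 b, dist (g b a) (f a) < η a :=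
        ((hgc b).dist hf).tendsto b |>.eventually_lt (hη.tendsto b)
          (by simpa [hgb] using hηD b hb)
      obtain ⟨ρ, hρ, h⟩ := Metric.eventually_nhds_iff.1 hev
      refine ⟨min (ρ / 2) (r / 8), fun _ => ⟨by positivity, min_le_right _ _, fun a ha => ?_⟩⟩
      exact (h (by linarith [min_le_left (ρ / 2) (r / 8)])).le
    · exact ⟨0, fun h => absurd h hb⟩
  choose δ hδ using hδ
  have huniq {b c : M} (hb : b ∈ D) (hc : c ∈ D) (h : dist b c < r) : b = c := by
    by_contra hne
    exact absurd (hD hb hc hne) h.not_ge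
  -- At `a = b ∈ D` the ball has radius 0, which forces the glued map to agree with `f` there.
  let t (a : M) : Set X := (φ a ∩ Metric.closedBall (f a) (η a)) ∩
    ⋂ b ∈ {b | b ∈ D ∧ dist a b ≤ δ b}, Metric.closedBall (f b) (L * dist a b)
  have ht (a : M) : Convex ℝ (t a) :=
    ((hconvex a).inter (convex_closedBall _ _)).inter
      (convex_iInter₂ fun _ _ => convex_closedBall _ _)
  have hlocal (x : M) : ∃ U ∈ 𝓝 x, ∃ g : M → X, ContinuousOn g U ∧ ∀ y ∈ U, g y ∈ t y := by
    by_cases hx : ∃ b ∈ D, dist x b < 2 * δ b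
    · obtain ⟨b, hb, hxb⟩ := hx
      refine ⟨Metric.ball b (2 * δ b), Metric.isOpen_ball.mem_nhds hxb, g b,
        (hgc b).continuousOn, fun y hy => ⟨⟨hgφ b y, (hδ b hb).2.2 y hy⟩, ?_⟩⟩
      refine mem_iInter₂.2 fun c ⟨hc, hyc⟩ => ?_
      rw [Metric.mem_ball] at hy
      obtain rfl : b = c := huniq hb hc (by
        linarith [dist_triangle_left b c y, (hδ b hb).2.1, (hδ c hc).2.1])
      exact hgL b y
    · push Not at hx
      suffices h : ∃ s > 0, ∀ y, dist y x < s → ∀ c ∈ D, ¬ dist y c ≤ δ c by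
        obtain ⟨s, hs, h⟩ := h
        refine ⟨Metric.ball x s, Metric.ball_mem_nhds x hs, f, hf.continuousOn,
          fun y hy => ⟨⟨hfφ y, Metric.mem_closedBall_self (hη₀ y)⟩, ?_⟩⟩
        exact mem_iInter₂.2 fun c ⟨hc, hyc⟩ => absurd hyc (h y hy c hc)
      -- `δ` may have no positive lower bound on `D`, so the only point of `D` that can be close to
      -- `x` is treated separately.
      by_cases hb : ∃ b ∈ D, dist x b < r / 2
      · obtain ⟨b, hb, hxb⟩ := hb
        refine ⟨min (r / 4) (δ b), lt_min (by positivity) (hδ b hb).1, fun y hy c hc hyc => ?_⟩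
        obtain ⟨hy₁, hy₂⟩ := lt_min_iff.1 hy
        obtain rfl : b = c := huniq hb hc (by
          linarith [dist_triangle_left b c x, dist_triangle_left x c y, (hδ c hc).2.1])
        linarith [hx b hb, dist_triangle_left x b y]
      · push Not at hb
        refine ⟨r / 4, by positivity, fun y hy c hc hyc => ?_⟩
        linarith [hb c hc, dist_triangle_left x c y, (hδ c hc).2.1]
  obtain ⟨h, hht⟩ := exists_continuous_forall_mem_convex_of_local ht hlocal
  have hhL (b : M) (hb : b ∈ D) (a : M) (ha : dist a b ≤ δ b) : dist (h a) (f b) ≤ L * dist a b :=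
    mem_iInter₂.1 (hht a).2 b ⟨hb, ha⟩
  refine ⟨h, h.continuous, fun a => (hht a).1.1, fun a => Metric.mem_closedBall'.1 (hht a).1.2,
    fun b hb => ⟨δ b, (hδ b hb).1, fun a ha => ?_⟩⟩
  have hhb : h b = f b := by
    simpa using hhL b hb b (by simpa using (hδ b hb).1.le)
  rw [hhb]
  exact hhL b hb a ha

/-- The extended distance matters for `B = ∅`, the initial stage: it gives `η = 1`, whereas the
real-valued `Metric.infDist` would give 0. -/
theorem exists_continuous_vanishing_on {M : Type*} [PseudoMetricSpace M] (B : Set M) :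
    ∃ η : M → ℝ, Continuous η ∧ (∀ a, 0 ≤ η a) ∧ (∀ a, η a ≤ 1) ∧
      (∀ b ∈ B, ∀ a, η a ≤ dist a b) ∧ ∀ a ∉ closure B, 0 < η a := by
  have htop (a : M) : min 1 (Metric.infEDist a B) ≠ ⊤ := ne_top_of_le_ne_top ENNReal.one_ne_top
    (min_le_left _ _)
  refine ⟨fun a => (min 1 (Metric.infEDist a B)).toReal, ?_, fun a => ENNReal.toReal_nonneg,
    fun a => ?_, fun b hb a => ?_, fun a ha => ?_⟩
  · exact ENNReal.continuousOn_toReal.comp_continuous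
      (continuous_const.min Metric.continuous_infEDist) htop
  · simpa using ENNReal.toReal_mono ENNReal.one_ne_top (min_le_left 1 (Metric.infEDist a B))
  · rw [dist_edist]
    exact ENNReal.toReal_mono (edist_ne_top _ _)
      ((min_le_right _ _).trans (Metric.infEDist_le_edist_of_mem hb))
  · refine ENNReal.toReal_pos (fun h => ha ?_) (htop a)
    rw [Metric.mem_closure_iff_infEDist_zero]
    simpa using (min_eq_iff.1 h).resolve_left (fun h => one_ne_zero h.1) |>.1

theorem pointwiseLipschitzAt_of_dist_le {M M' : Type*} [MetricSpace M] [MetricSpace M']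
    {β : ℝ≥0} {f : M → M'} {b : M} {δ : ℝ} (hδ : 0 < δ)
    (h : ∀ a, dist a b ≤ δ → dist (f a) (f b) ≤ β * dist a b) : PointwiseLipschitzAt β f b := by
  refine limsup_le_of_le (by isBoundedDefault) ?_
  filter_upwards [Ioc_mem_nhdsGT hδ] with r hr
  rw [mul_comm, ← div_eq_mul_inv]
  refine ENNReal.div_le_of_le_mul (iSup₂_le fun a ha => ?_)
  rw [Metric.mem_closedBall] at ha
  rw [edist_comm, edist_dist, ← ENNReal.ofReal_coe_nnreal, ← ENNReal.ofReal_mul β.coe_nonneg]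
  exact ENNReal.ofReal_le_ofReal ((h a (ha.trans hr.2)).trans (by gcongr))

/-! ### Iteration and passage to the limit -/

/-- Every continuous selection of a correspondence that has, through every point of its graph, a
continuous selection that is `L`-Lipschitz at this point, is uniformly close to a continuous
selection that is pointwise Lipschitz on a dense set. -/
theorem IsSelection.exists_pointwiseLipschitzOn_dense {M X : Type*} [MetricSpace M]
    [NormedAddCommGroup X] [NormedSpace ℝ X] [CompleteSpace X] {φ : M → Set X}
    (hclosed : ∀ a, IsClosed (φ a)) (hconvex : ∀ a, Convex ℝ (φ a)) {L ε : ℝ≥0} (hε : 0 < ε)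
    (hg : ∀ b, ∀ y ∈ φ b, ∃ g : M → X, Continuous g ∧ IsSelection φ g ∧
      ∀ a, dist (g a) y ≤ L * dist a b)
    {f₀ : M → X} (hf₀ : Continuous f₀) (hf₀φ : IsSelection φ f₀) :
    ∃ f : M → X, Continuous f ∧ IsSelection φ f ∧ (∀ a, dist (f₀ a) (f a) ≤ ε) ∧
      ∃ B : Set M, Dense B ∧ PointwiseLipschitzOn (L + ε) f B := by
  have step (n : ℕ) (p : {p : (M → X) × Set M // Continuous p.1 ∧ IsSelection φ p.1}) :
      ∃ q : {p : (M → X) × Set M // Continuous p.1 ∧ IsSelection φ p.1},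
        (∀ a, dist (p.1.1 a) (q.1.1 a) ≤ ε / 2 / 2 ^ n) ∧
        (∀ b ∈ p.1.2, ∀ a, dist (p.1.1 a) (q.1.1 a) ≤ ε / 2 / 2 ^ n * dist a b) ∧
        p.1.2 ⊆ q.1.2 ∧
        (∀ b ∈ q.1.2, b ∉ p.1.2 →
          ∃ δ > 0, ∀ a, dist a b ≤ δ → dist (q.1.1 a) (q.1.1 b) ≤ L * dist a b) ∧
        ∀ x, ∃ b ∈ closure q.1.2, dist x b < 1 / (n + 1) := by
    obtain ⟨⟨f, B⟩, hf, hfφ⟩ := p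
    obtain ⟨D, hD, hcover⟩ := exists_maximal_separated M (r := 1 / ((n : ℝ) + 1)) (by positivity)
    obtain ⟨η, hη, hη₀, hη₁, hηB, hηpos⟩ := exists_continuous_vanishing_on B
    have hc : (0 : ℝ) < ε / 2 / 2 ^ n := by positivity
    -- Points of `D` in `closure B` are dropped, since `η` vanishes there; density loses nothing, as
    -- `B` already accumulates at them.
    obtain ⟨g, hgc, hgφ, hfg, hgL⟩ := IsSelection.exists_perturbation hconvex hf hfφ
      (fun b => hg b (f b) (hfφ b)) (η := fun a => ε / 2 / 2 ^ n * η a)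
      (continuous_const.mul hη) (fun a => mul_nonneg hc.le (hη₀ a))
      (D := D \ closure B) (r := 1 / ((n : ℝ) + 1)) (by positivity) (hD.mono sdiff_subset)
      (fun b hb => mul_pos hc (hηpos b hb.2))
    refine ⟨⟨(g, B ∪ D \ closure B), hgc, hgφ⟩,
      fun a => (hfg a).trans (mul_le_of_le_one_right hc.le (hη₁ a)),
      fun b hb a => (hfg a).trans (mul_le_mul_of_nonneg_left (hηB b hb a) hc.le),
      subset_union_left, fun b hb hbB => hgL b (hb.resolve_left hbB), fun x => ?_⟩
    obtain ⟨b, hb, hxb⟩ := hcover x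
    refine ⟨b, ?_, hxb⟩
    by_cases hbB : b ∈ closure B
    · exact closure_mono subset_union_left hbB
    · exact subset_closure (Or.inr ⟨hb, hbB⟩)
  choose next hclose hcloseB hsub hlip hcover using step
  let P (n : ℕ) : {p : (M → X) × Set M // Continuous p.1 ∧ IsSelection φ p.1} :=
    Nat.rec ⟨(f₀, ∅), hf₀, hf₀φ⟩ (fun n p => next n p) n
  let F (n : ℕ) : M → X := (P n).1.1
  let B (n : ℕ) : Set M := (P n).1.2
  have hF (a : M) (n : ℕ) : dist (F n a) (F (n + 1) a) ≤ ε / 2 / 2 ^ n := hclose n (P n) a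
  have hB : Monotone B := monotone_nat_of_le_succ fun n => hsub n (P n)
  choose f hf using fun a =>
    cauchySeq_tendsto_of_complete (cauchySeq_of_le_geometric_two (hF a))
  have hdist (a : M) (n : ℕ) : dist (F n a) (f a) ≤ ε / 2 ^ n :=
    dist_le_of_le_geometric_two_of_tendsto (hF a) (hf a) n
  have hdistB {n : ℕ} {b : M} (hb : b ∈ B n) (a : M) : dist (F n a) (f a) ≤ ε * dist a b := by
    refine dist_le_of_le_geometric_two_of_tendsto₀ (f := fun k => F (n + k) a)
      (C := ε * dist a b) (fun k => ?_) ((hf a).comp (tendsto_add_atTop_nat n |>.congr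
        fun k => add_comm k n))
    refine (hcloseB (n + k) (P (n + k)) b (hB (Nat.le_add_right n k) hb) a).trans ?_
    have : (ε : ℝ) / 2 / 2 ^ (n + k) ≤ ε / 2 / 2 ^ k := by
      gcongr
      · norm_num
      · omega
    calc (ε : ℝ) / 2 / 2 ^ (n + k) * dist a b ≤ ε / 2 / 2 ^ k * dist a b := by gcongr
      _ = ε * dist a b / 2 / 2 ^ k := by ring
  refine ⟨f, ?_, fun a => ?_, fun a => ?_, ⋃ n, B n, ?_, fun b hb => ?_⟩
  · have hunif : TendstoUniformly F f atTop := by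
      rw [Metric.tendstoUniformly_iff]
      intro s hs
      have hzero : Tendsto (fun n : ℕ => (ε : ℝ) / 2 ^ n) atTop (𝓝 0) :=
        tendsto_const_nhds.div_atTop (tendsto_pow_atTop_atTop_of_one_lt one_lt_two)
      filter_upwards [hzero.eventually_lt_const hs] with n hn a
      rw [dist_comm]
      exact (hdist a n).trans_lt hn
    exact hunif.continuous (Frequently.of_forall fun n => (P n).2.1)
  · exact (hclosed a).mem_of_tendsto (hf a) (Eventually.of_forall fun n => (P n).2.2 a)
  · exact (hdist a 0).trans_eq (by simp)
  · rw [← dense_closure]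
    refine Metric.dense_iff.2 fun x s hs => ?_
    obtain ⟨n, hn⟩ := exists_nat_one_div_lt hs
    obtain ⟨b, hb, hxb⟩ := hcover n (P n) x
    exact ⟨b, Metric.mem_ball'.2 (hxb.trans hn),
      closure_mono (subset_iUnion B (n + 1)) hb⟩
  -- The stage at which `b` enters; it is a successor because `B 0 = ∅`.
  · obtain ⟨n, hbn, hmin⟩ : ∃ n, b ∈ B (n + 1) ∧ b ∉ B n := by
      classical
      have hex := mem_iUnion.1 hb
      obtain ⟨n, hn⟩ : ∃ n, Nat.find hex = n + 1 := Nat.exists_eq_succ_of_ne_zero fun h => by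
        have := Nat.find_spec hex
        rw [h] at this
        exact this
      exact ⟨n, hn ▸ Nat.find_spec hex, Nat.find_min hex (by omega)⟩
    obtain ⟨δ, hδ, h⟩ := hlip n (P n) b hbn hmin
    refine pointwiseLipschitzAt_of_dist_le hδ fun a ha => ?_
    have hb' : F (n + 1) b = f b := by simpa using hdistB (n := n + 1) hbn b
    have h₁ : dist (F (n + 1) a) (F (n + 1) b) ≤ L * dist a b := h a ha
    rw [hb'] at h₁
    push_cast
    rw [add_mul]
    linarith [dist_triangle_left (f a) (f b) (F (n + 1) a), hdistB (n := n + 1) hbn a]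

theorem mainTheorem3 {M X : Type*} [MetricSpace M] [NormedAddCommGroup X] [NormedSpace ℝ X]
    [CompleteSpace X] (α : ℝ≥0) (φ : M → Set X)
    (hne : ∀ a, (φ a).Nonempty) (hclosed : ∀ a, IsClosed (φ a)) (hconvex : ∀ a, Convex ℝ (φ a))
    (hlhc : LowerHemicontinuous φ)
    (hlip : ∀ ε : ℝ≥0, 0 < ε → LowerPointwiseLipschitz (α + ε) φ) :
    (∀ β : ℝ≥0, α < β → ∃ f : M → X, Continuous f ∧ IsSelection φ f ∧
        ∃ B : Set M, Dense B ∧ PointwiseLipschitzOn β f B) ∧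
      ((∃ g : M → X, Continuous g ∧ IsSelection φ g ∧ Bornology.IsBounded (range g)) →
        ∀ β : ℝ≥0, α < β → ∃ f : M → X, Continuous f ∧ IsSelection φ f ∧
          Bornology.IsBounded (range f) ∧
          ∃ B : Set M, Dense B ∧ PointwiseLipschitzOn β f B) := by
  have key : ∀ β : ℝ≥0, α < β → ∃ ε : ℝ≥0, ∀ f₀ : M → X, Continuous f₀ → IsSelection φ f₀ →
      ∃ f : M → X, Continuous f ∧ IsSelection φ f ∧ (∀ a, dist (f₀ a) (f a) ≤ ε) ∧
        ∃ B : Set M, Dense B ∧ PointwiseLipschitzOn β f B := by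
    intro β hβ
    -- The gap from `K` to `L` makes the open balls meet `φ`; the gap `β - L` pays for later
    -- perturbations.
    obtain ⟨L, hαL, hLβ⟩ := exists_between hβ
    obtain ⟨K, hαK, hKL⟩ := exists_between hαL
    have hlipK : LowerPointwiseLipschitz K φ := by
      simpa [add_tsub_cancel_of_le hαK.le] using hlip (K - α) (tsub_pos_of_lt hαK)
    refine ⟨β - L, fun f₀ hf₀ hf₀φ => ?_⟩
    have h := IsSelection.exists_pointwiseLipschitzOn_dense hclosed hconvex (L := L)
      (tsub_pos_of_lt hLβ) (fun b y hy => hlipK.exists_continuous_selection_dist_le hlhc hclosed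
        hconvex hKL b hy) hf₀ hf₀φ
    rwa [add_tsub_cancel_of_le hLβ.le] at h
  refine ⟨fun β hβ => ?_, fun ⟨g, hg, hgφ, hbdd⟩ β hβ => ?_⟩
  · obtain ⟨ε, h⟩ := key β hβ
    obtain ⟨f₀, hf₀, hf₀φ⟩ := hlhc.exists_continuous_selection hne hclosed hconvex
    obtain ⟨f, hf, hfφ, -, hB⟩ := h f₀ hf₀ hf₀φ
    exact ⟨f, hf, hfφ, hB⟩
  · obtain ⟨ε, h⟩ := key β hβ
    obtain ⟨f, hf, hfφ, hgf, hB⟩ := h g hg hgφ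
    refine ⟨f, hf, hfφ, (hbdd.cthickening (δ := ε)).subset ?_, hB⟩
    rintro _ ⟨a, rfl⟩
    exact Metric.mem_cthickening_of_dist_le _ (g a) _ _ (mem_range_self a)
      (dist_comm (g a) (f a) ▸ hgf a)
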